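/- **Lemma (the HHO stabilisation satisfies the lower and face-only upper bounds uniformly in the polynomial degrees).** *Mesh.* Let $d\ge 2$ and let $\Omega\subset\mathbb R^d$ be a polytopal domain. Let $(\mathcal T_h,\mathcal F_h)$ be a polytopal mesh of $\Omega$: $\mathcal T_h$ is a finite set of pairwise disjoint polytopes (connected interiors of finite unions of closed $d$-simplices) with $\overline\Omega=\bigcup_{T}\overline T$; $\mathcal F_h$ is a finite set of pairwise disjoint faces, each a nonempty relatively open part of a hyperplane with relative boundary of zero $(d-1)$-dimensional measure, each contained either in $\partial T\cap\partial T'$ for two distinct elements $T,T'$ or in $\partial T\cap\partial\Omega$ for some element $T$, with $\bigcup_T\partial T=\bigcup_F\overline F$. For $T\in\mathcal T_h$ let $h_T$ be its diameter, $\mathcal F_T=\{F\in\mathcal F_h: F\subset\partial T\}$, and let $n_{\partial T}$ be the outward unit normal, assumed constant on each $F\in\mathcal F_T$. Let $\varrho>0$ and assume that every $T\in\mathcal T_h$ is *connected by star-shaped sets with parameter $\varrho$*: $T$ is the union of finitely many open sets $V_1,\dots,V_N$, each $V_i$ contains a ball of radius $\varrho\,\mathrm{diam}(V_i)$ with respect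 to every point of which it is star-shaped, and any two of the $V_i$ are linked by a chain of such sets in which consecutive ones intersect in a set of measure at least that of a ball of radius $\varrho h_T$ (for instance, because the intersection contains such a ball). *Local spaces and operators.* Let $k,l\in\mathbb N$ with $l\ge k-1$. Write $(\cdot,\cdot)_X$ and $\|\cdot\|_X$ for the $L^2$ inner product and norm on $X\in\{T,\partial T\}$ (Lebesgue and surface measure respectively). Let $\mathbb P^{\ell}(X)$ be the polynomials of degree $\le\ell$ on an element or face $X$, $\mathbb P^k(\mathcal F_T)$ the functions on $\partial T$ whose restriction to each $F\in\mathcal F_T$ is in $\mathbb P^k(F)$, $\pi_T^{0,l}$ the $L^2(T)$-orthogonal projector on $\mathbb P^l(T)$, and $\pi_{\mathcal F_T}^{0,k}$ the operator acting on each $F\in\mathcal F_T$ as the $L^2(F)$-orthogonal projector on $\mathbb P^k(F)$. For $\underline v_T=(v_T,v_{\mathcal F_T})\in \underline U_T^{k,l}:=\mathbb P^l(T)\times\mathbb P^k(\mathcal F_T)$, let $p_T^{k+1}\underline v_T\in\mathbb P^{k+1}(T)$ be the unique polynomial such that $$(\nabla p_T^{k+1}\underline v_T,\nabla w)_T=-(v_T,\Delta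 w)_T+(v_{\mathcal F_T},\nabla w\cdot n_{\partial T})_{\partial T}\quad\forall w\in\mathbb P^{k+1}(T),\qquad (v_T-p_T^{k+1}\underline v_T,1)_T=0,$$ and set $$\delta_T^l\underline v_T:=\pi_T^{0,l}(p_T^{k+1}\underline v_T-v_T),\qquad \delta_{\mathcal F_T}^k\underline v_T:=\pi_{\mathcal F_T}^{0,k}(p_T^{k+1}\underline v_T-v_{\mathcal F_T}).$$ Define $$s_T(\underline u_T,\underline v_T):=h_T^{-2}(\delta_T^l\underline u_T,\delta_T^l\underline v_T)_T+h_T^{-1}(\delta_{\mathcal F_T}^k\underline u_T,\delta_{\mathcal F_T}^k\underline v_T)_{\partial T},$$ $$a_T(\underline u_T,\underline v_T):=(\nabla p_T^{k+1}\underline u_T,\nabla p_T^{k+1}\underline v_T)_T+s_T(\underline u_T,\underline v_T).$$ *Claim.* There is a constant $C>0$ depending only on $d$ and $\varrho$ (in particular not on $\Omega$, the mesh, its size $h$, $T$, $k$ or $l$) such that, for every $\Omega$, mesh, $T\in\mathcal T_h$, $k$ and $l$ as above, $$\|\nabla p_T^{k+1}\underline v_T\|_T^2+h_T^{-1}\|\delta_{\mathcal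 F_T}^k\underline v_T\|_{\partial T}^2\le C\,a_T(\underline v_T,\underline v_T)\qquad\forall\,\underline v_T\in\underline U_T^{k,l},$$ and, for every $\underline v_{T,\partial}=(0,v_{\mathcal F_T})\in\underline U_T^{k,l}$, $$a_T(\underline v_{T,\partial},\underline v_{T,\partial})\le C\Big(\|\nabla p_T^{k+1}\underline v_{T,\partial}\|_T^2+h_T^{-1}\|\delta_{\mathcal F_T}^k\underline v_{T,\partial}\|_{\partial T}^2\Big).$$ -/

import Mathlib

open MeasureTheory Set Filter Topology Metric
open scoped Gradient Laplacian RealInnerProductSpace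

noncomputable section

namespace HHO

/-- The Euclidean space `ℝ^d`. -/
abbrev Space (d : ℕ) := EuclideanSpace ℝ (Fin d)

/-! ### Geometry: polytopes, star-shaped sets, polytopal meshes -/

/-- A polytope: a (nonempty) connected set that is the interior of a finite union of closed
non-degenerate `d`-simplices. -/
def IsPolytope {d : ℕ} (P : Set (Space d)) : Prop :=
  IsConnected P ∧ ∃ S : Set (Affine.Simplex ℝ (Space d) d), S.Finite ∧
    P = interior (⋃ s ∈ S, convexHull ℝ (range s.points))

/-- `U` is a bounded open set connected by star-shaped sets with parameter `ϱ`: it is a finite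
union of open sets `V i`, each star-shaped with respect to every point of a ball of radius
`ϱ * diam (V i)` that it contains, and any two of them are linked by a chain in which consecutive
sets overlap on a set of measure at least that of a ball of radius `ϱ * diam U` (in particular
this holds if the overlap contains such a ball). No bound on the number of sets is needed. -/
def ConnectedByStarShaped {d : ℕ} (ϱ : ℝ) (U : Set (Space d)) : Prop :=
  IsOpen U ∧ Bornology.IsBounded U ∧
  ∃ (N : ℕ) (V : Fin N → Set (Space d)),
    (∀ i, IsOpen (V i)) ∧ U = ⋃ i, V i ∧
    (∀ i, ∃ c : Space d, ball c (ϱ * diam (V i)) ⊆ V i ∧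
      ∀ y ∈ ball c (ϱ * diam (V i)), StarConvex ℝ y (V i)) ∧
    ∀ i j, Relation.ReflTransGen
      (fun a b => volume (ball (0 : Space d) (ϱ * diam U)) ≤ volume (V a ∩ V b)) i j

/-- `n` is the (constant) unit normal to the flat face `F` pointing outside `T`. -/
def IsOutwardNormal {d : ℕ} (T F : Set (Space d)) (n : Space d) : Prop :=
  ‖n‖ = 1 ∧ (∀ x ∈ F, ∀ y ∈ F, ⟪n, x - y⟫ = 0) ∧
  ∀ᵐ x ∂((μHE[d - 1] : Measure (Space d)).restrict F),
    ∀ᶠ t : ℝ in 𝓝[>] 0, x + t • n ∉ T ∧ x - t • n ∈ T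

/-- A polytopal mesh of the domain `Ω`: a finite set of mesh elements and a finite set of mesh
faces. A face is a nonempty, relatively open part of a hyperplane. -/
structure PolytopalMesh {d : ℕ} (Ω : Set (Space d)) where
  elements : Finset (Set (Space d))
  faces : Finset (Set (Space d))
  element_polytope : ∀ T ∈ elements, IsPolytope T
  element_disjoint : ∀ T ∈ elements, ∀ T' ∈ elements, T ≠ T' → Disjoint T T'
  closure_eq : closure Ω = ⋃ T ∈ elements, closure T
  face_nonempty : ∀ F ∈ faces, F.Nonempty
  face_flat : ∀ F ∈ faces, ∃ (H : AffineSubspace ℝ (Space d)) (O : Set (Space d)),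
    Module.finrank ℝ H.direction + 1 = d ∧ IsOpen O ∧ F = O ∩ H
  face_relBoundary_null : ∀ F ∈ faces, (μHE[d - 1] : Measure (Space d)) (closure F \ F) = 0
  face_disjoint : ∀ F ∈ faces, ∀ F' ∈ faces, F ≠ F' → Disjoint F F'
  /-- Each face is either an interface between two elements or a boundary face. -/
  face_interface_or_boundary : ∀ F ∈ faces,
    (∃ T ∈ elements, ∃ T' ∈ elements, T ≠ T' ∧ F ⊆ frontier T ∩ frontier T') ∨
    (∃ T ∈ elements, F ⊆ frontier T ∩ frontier Ω)
  skeleton_eq : ⋃ T ∈ elements, frontier T = ⋃ F ∈ faces, closure F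
  /-- An element lies on one given side of each of its faces, so that the constant outward unit
  normal makes sense. -/
  exists_normal : ∀ T ∈ elements, ∀ F ∈ faces, F ⊆ frontier T → ∃ n, IsOutwardNormal T F n

/-- The set `𝓕_T` of the faces attached to the element `T`. -/
def PolytopalMesh.facesOf {d : ℕ} {Ω : Set (Space d)} (M : PolytopalMesh Ω) (T : Set (Space d)) :
    Finset (Set (Space d)) :=
  open Classical in M.faces.filter (fun F => F ⊆ frontier T)

/-- Mesh regularity with parameter `ϱ`. -/
def PolytopalMesh.IsRegular {d : ℕ} {Ω : Set (Space d)} (M : PolytopalMesh Ω) (ϱ : ℝ) : Prop :=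
  ∀ T ∈ M.elements, ConnectedByStarShaped ϱ T

/-- The outward unit normal `n_{TF}`. -/
def faceNormal {d : ℕ} (T F : Set (Space d)) : Space d :=
  open Classical in if h : ∃ n, IsOutwardNormal T F n then h.choose else 0

/-- The piecewise constant outward unit normal `n_{∂T}`, equal to `n_{TF}` on each `F ∈ 𝓕_T`. -/
def boundaryNormal {d : ℕ} (T : Set (Space d)) (𝓕 : Finset (Set (Space d))) (x : Space d) :
    Space d :=
  ∑ F ∈ 𝓕, F.indicator (fun _ => faceNormal T F) x

/-! ### Polynomial spaces and `L²` projectors -/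

/-- Evaluation of a polynomial in `d` variables as a function on `ℝ^d`. -/
def polyEval (d : ℕ) : MvPolynomial (Fin d) ℝ →ₗ[ℝ] (Space d → ℝ) :=
  LinearMap.pi fun x => (MvPolynomial.aeval fun i => x i).toLinearMap

/-- Polynomial functions of total degree `≤ ℓ` on `ℝ^d`. On a nonempty open set `T`, they are
identified with their restrictions, so that this also stands for `ℙ^ℓ(T)`. -/
def polyFun (d ℓ : ℕ) : Submodule ℝ (Space d → ℝ) :=
  (MvPolynomial.restrictTotalDegree (Fin d) ℝ ℓ).map (polyEval d)

/-- The space `ℙ^ℓ(𝓕_T)` of piecewise polynomials on the faces in `𝓕`: functions whose restriction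
to each face is a polynomial of degree `≤ ℓ`. Values outside the faces (a null set of `∂T`) are
normalised to `0`. -/
def brokenPoly {d : ℕ} (𝓕 : Finset (Set (Space d))) (ℓ : ℕ) : Submodule ℝ (Space d → ℝ) where
  carrier := {v | (∀ x, (∀ F ∈ 𝓕, x ∉ F) → v x = 0) ∧
    ∀ F ∈ 𝓕, ∃ p ∈ polyFun d ℓ, EqOn v p F}
  zero_mem' := ⟨fun _ _ => rfl, fun _ _ => ⟨0, zero_mem _, fun _ _ => rfl⟩⟩
  add_mem' := by
    rintro u v ⟨hu, hu'⟩ ⟨hv, hv'⟩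
    refine ⟨fun x hx => by simp [hu x hx, hv x hx], fun F hF => ?_⟩
    obtain ⟨p, hp, hup⟩ := hu' F hF
    obtain ⟨q, hq, hvq⟩ := hv' F hF
    exact ⟨p + q, add_mem hp hq, fun x hx => by simp [hup hx, hvq hx]⟩
  smul_mem' := by
    rintro c v ⟨hv, hv'⟩
    refine ⟨fun x hx => by simp [hv x hx], fun F hF => ?_⟩
    obtain ⟨q, hq, hvq⟩ := hv' F hF
    exact ⟨c • q, Submodule.smul_mem _ c hq, fun x hx => by simp [hvq hx]⟩

/-- `p` is an `L²(μ)`-orthogonal projection of `v` on the polynomials of degree `≤ ℓ`. -/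
def IsL2Projection {d : ℕ} (μ : Measure (Space d)) (ℓ : ℕ) (v p : Space d → ℝ) : Prop :=
  p ∈ polyFun d ℓ ∧ ∀ w ∈ polyFun d ℓ, ∫ x, (v x - p x) * w x ∂μ = 0

/-- The `L²(μ)`-orthogonal projection of `v` on the polynomials of degree `≤ ℓ`. -/
def l2Projection {d : ℕ} (μ : Measure (Space d)) (ℓ : ℕ) (v : Space d → ℝ) : Space d → ℝ :=
  open Classical in if h : ∃ p, IsL2Projection μ ℓ v p then h.choose else 0

/-- The projector `π_T^{0,ℓ}` on `ℙ^ℓ(T)`. -/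
def elemProj {d : ℕ} (T : Set (Space d)) (ℓ : ℕ) (v : Space d → ℝ) : Space d → ℝ :=
  l2Projection (volume.restrict T) ℓ v

/-- The projector `π_{𝓕_T}^{0,ℓ}` on `ℙ^ℓ(𝓕_T)`, given on each face `F` by the `L²(F)`-orthogonal
projector on `ℙ^ℓ(F)`. -/
def facesProj {d : ℕ} (𝓕 : Finset (Set (Space d))) (ℓ : ℕ) (v : Space d → ℝ) : Space d → ℝ :=
  fun x => ∑ F ∈ 𝓕, F.indicator (l2Projection ((μHE[d - 1] : Measure (Space d)).restrict F) ℓ v) x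

/-! ### Local HHO construction -/

/-- `(f, g)_T`. -/
def elemInner {d : ℕ} (T : Set (Space d)) (f g : Space d → ℝ) : ℝ :=
  ∫ x in T, f x * g x

/-- `(∇f, ∇g)_T`. -/
def gradInner {d : ℕ} (T : Set (Space d)) (f g : Space d → ℝ) : ℝ :=
  ∫ x in T, ⟪∇ f x, ∇ g x⟫

/-- `(f, g)_{∂T}`, with respect to the surface measure. -/
def bdryInner {d : ℕ} (T : Set (Space d)) (f g : Space d → ℝ) : ℝ :=
  ∫ x in frontier T, f x * g x ∂(μHE[d - 1] : Measure (Space d))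

/-- The local space of unknowns `U_T^{k,l} = ℙ^l(T) × ℙ^k(𝓕_T)`. -/
abbrev LocalSpace {d : ℕ} (𝓕 : Finset (Set (Space d))) (k l : ℕ) :=
  polyFun d l × brokenPoly 𝓕 k

section Local

variable {d : ℕ} (T : Set (Space d)) (𝓕 : Finset (Set (Space d))) {k l : ℕ}

/-- The equations that define the potential reconstruction `p = p_T^{k+1} v`. -/
def IsPotential (v : LocalSpace 𝓕 k l) (p : Space d → ℝ) : Prop :=
  p ∈ polyFun d (k + 1) ∧
  (∀ w ∈ polyFun d (k + 1),
    gradInner T p w = -elemInner T (v.1 : Space d → ℝ) (Δ w) +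
      bdryInner T (v.2 : Space d → ℝ) (fun x => ⟪∇ w x, boundaryNormal T 𝓕 x⟫)) ∧
  ∫ x in T, ((v.1 : Space d → ℝ) x - p x) = 0

/-- The potential reconstruction `p_T^{k+1} v`. -/
def potential (v : LocalSpace 𝓕 k l) : Space d → ℝ :=
  open Classical in if h : ∃ p, IsPotential T 𝓕 v p then h.choose else 0

/-- The element difference `δ_T^l v = π_T^{0,l} (p_T^{k+1} v - v_T)`. -/
def deltaElem (v : LocalSpace 𝓕 k l) : Space d → ℝ :=
  elemProj T l (potential T 𝓕 v - (v.1 : Space d → ℝ))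

/-- The boundary difference `δ_{𝓕_T}^k v = π_{𝓕_T}^{0,k} (p_T^{k+1} v - v_{𝓕_T})`. -/
def deltaBdry (v : LocalSpace 𝓕 k l) : Space d → ℝ :=
  facesProj 𝓕 k (potential T 𝓕 v - (v.2 : Space d → ℝ))

/-- The stabilisation
`s_T(u, v) = h_T^{-2} (δ_T^l u, δ_T^l v)_T + h_T^{-1} (δ_{𝓕_T}^k u, δ_{𝓕_T}^k v)_{∂T}`. -/
def stab (u v : LocalSpace 𝓕 k l) : ℝ :=
  (diam T ^ 2)⁻¹ * elemInner T (deltaElem T 𝓕 u) (deltaElem T 𝓕 v) +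
    (diam T)⁻¹ * bdryInner T (deltaBdry T 𝓕 u) (deltaBdry T 𝓕 v)

/-- The local bilinear form
`a_T(u, v) = (∇p_T^{k+1} u, ∇p_T^{k+1} v)_T + s_T(u, v)` built on a stabilisation `s = s_T`. -/
def localForm (s : LocalSpace 𝓕 k l → LocalSpace 𝓕 k l → ℝ) (u v : LocalSpace 𝓕 k l) : ℝ :=
  gradInner T (potential T 𝓕 u) (potential T 𝓕 v) + s u v

/-- `‖∇p_T^{k+1} v‖_T² + h_T^{-1} ‖δ_{𝓕_T}^k v‖_{∂T}²`. -/
def reducedEnergy (v : LocalSpace 𝓕 k l) : ℝ :=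
  gradInner T (potential T 𝓕 v) (potential T 𝓕 v) +
    (diam T)⁻¹ * bdryInner T (deltaBdry T 𝓕 v) (deltaBdry T 𝓕 v)

/-- The two conditions required from a stabilisation `s = s_T`, with constant `C`: the lower bound
for all local unknowns, and the upper bound for those with zero element component. -/
def SatisfiesStabBounds (s : LocalSpace 𝓕 k l → LocalSpace 𝓕 k l → ℝ) (C : ℝ) : Prop :=
  (∀ v : LocalSpace 𝓕 k l, reducedEnergy T 𝓕 v ≤ C * localForm T 𝓕 s v v) ∧
  ∀ v : brokenPoly 𝓕 k, localForm T 𝓕 s (0, v) (0, v) ≤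
    C * reducedEnergy T 𝓕 ((0, v) : LocalSpace 𝓕 k l)

end Local

/-! ### Well-posedness of the projectors and of the potential reconstruction -/

theorem polyFun_analytic {d ℓ : ℕ} {w : Space d → ℝ} (hw : w ∈ polyFun d ℓ) :
    AnalyticOnNhd ℝ w univ := by
  obtain ⟨p, -, rfl⟩ := hw
  have h : ∀ i, AnalyticOnNhd ℝ (fun x : Space d => x i) univ := fun i =>
    (EuclideanSpace.proj (𝕜 := ℝ) i).analyticOnNhd univ
  exact AnalyticOnNhd.aeval_mvPolynomial h p

theorem polyFun_contDiff {d ℓ : ℕ} {w : Space d → ℝ} (hw : w ∈ polyFun d ℓ) {n : ℕ} :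
    ContDiff ℝ n w :=
  contDiffOn_univ.1 (polyFun_analytic hw).contDiffOn_of_completeSpace

theorem polyFun_continuous_grad {d ℓ : ℕ} {w : Space d → ℝ} (hw : w ∈ polyFun d ℓ) :
    Continuous (∇ w) :=
  (InnerProductSpace.toDual ℝ (Space d)).symm.continuous.comp
    ((polyFun_contDiff hw (n := 1)).continuous_fderiv (by simp))

theorem polyFun_continuous_laplacian {d ℓ : ℕ} {w : Space d → ℝ} (hw : w ∈ polyFun d ℓ) :
    Continuous (Δ w) := by
  rw [InnerProductSpace.laplacian_eq_iteratedFDeriv_stdOrthonormalBasis]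
  have := (polyFun_contDiff hw (n := 2)).continuous_iteratedFDeriv (m := 2) (by norm_cast)
  fun_prop

theorem exists_riesz {V : Type*} [AddCommGroup V] [Module ℝ V] [FiniteDimensional ℝ V]
    (A : V →ₗ[ℝ] V →ₗ[ℝ] ℝ) (L : V →ₗ[ℝ] ℝ)
    (h : ∀ x, A x x = 0 → L x = 0) : ∃ p, ∀ w, A p w = L w := by
  have : L ∈ LinearMap.range A := by
    rw [← Subspace.dualCoannihilator_dualAnnihilator_eq (W := LinearMap.range A),
      Submodule.mem_dualAnnihilator]
    intro x hx
    rw [Submodule.mem_dualCoannihilator] at hx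
    exact h x (hx _ ⟨x, rfl⟩)
  obtain ⟨p, hp⟩ := this
  exact ⟨p, fun w => by rw [hp]⟩

theorem integrable_of_continuous {d : ℕ} {μ : Measure (Space d)} [IsFiniteMeasure μ]
    {R : Set (Space d)} (hR : Bornology.IsBounded R) (hμ : ∀ᵐ x ∂μ, x ∈ R)
    {f : Space d → ℝ} (hf : Continuous f) : Integrable f μ := by
  obtain ⟨C, hC⟩ := hR.isCompact_closure.exists_bound_of_continuousOn hf.continuousOn
  refine Integrable.of_bound hf.aestronglyMeasurable C ?_
  filter_upwards [hμ] with x hx using hC x (subset_closure hx)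

theorem integrable_mul_continuous {d : ℕ} {μ : Measure (Space d)}
    {R : Set (Space d)} (hR : Bornology.IsBounded R) (hμ : ∀ᵐ x ∂μ, x ∈ R)
    {v f : Space d → ℝ} (hv : Integrable v μ) (hf : Continuous f) :
    Integrable (fun x => v x * f x) μ := by
  obtain ⟨C, hC⟩ := hR.isCompact_closure.exists_bound_of_continuousOn hf.continuousOn
  refine hv.mul_bdd (c := C) hf.aestronglyMeasurable ?_
  filter_upwards [hμ] with x hx using hC x (subset_closure hx)

/-- The `L²` projection of an integrable function exists. -/
theorem exists_isL2Projection {d : ℕ} {μ : Measure (Space d)} [IsFiniteMeasure μ]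
    {R : Set (Space d)} (hR : Bornology.IsBounded R) (hμ : ∀ᵐ x ∂μ, x ∈ R) (ℓ : ℕ)
    {v : Space d → ℝ} (hv : Integrable v μ) : ∃ p, IsL2Projection μ ℓ v p := by
  have hc : ∀ w : polyFun d ℓ, Continuous (w : Space d → ℝ) := fun w =>
    (polyFun_contDiff w.2 (n := 0)).continuous
  have hi : ∀ w : polyFun d ℓ, Integrable (w : Space d → ℝ) μ := fun w =>
    integrable_of_continuous hR hμ (hc w)
  have hvi : ∀ w : polyFun d ℓ, Integrable (fun x => v x * (w : Space d → ℝ) x) μ := fun w =>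
    integrable_mul_continuous hR hμ hv (hc w)
  have hwi : ∀ u w : polyFun d ℓ,
      Integrable (fun x => (u : Space d → ℝ) x * (w : Space d → ℝ) x) μ := fun u w =>
    integrable_mul_continuous hR hμ (hi u) (hc w)
  have : FiniteDimensional ℝ (polyFun d ℓ) := by unfold polyFun; infer_instance
  let A : polyFun d ℓ →ₗ[ℝ] polyFun d ℓ →ₗ[ℝ] ℝ := LinearMap.mk₂ ℝ
    (fun u w => ∫ x, (u : Space d → ℝ) x * (w : Space d → ℝ) x ∂μ)
    (fun a b c => by
      rw [← integral_add (hwi a c) (hwi b c)]; congr 1; ext x; simp [add_mul])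
    (fun r a c => by
      rw [smul_eq_mul, ← integral_const_mul]; congr 1; ext x; simp [mul_assoc])
    (fun a b c => by
      rw [← integral_add (hwi a b) (hwi a c)]; congr 1; ext x; simp [mul_add])
    (fun r a c => by
      rw [smul_eq_mul, ← integral_const_mul]; congr 1; ext x; simp [mul_left_comm])
  let L : polyFun d ℓ →ₗ[ℝ] ℝ :=
    { toFun := fun w => ∫ x, v x * (w : Space d → ℝ) x ∂μ
      map_add' := fun a b => by
        rw [← integral_add (hvi a) (hvi b)]; congr 1; ext x; simp [mul_add]
      map_smul' := fun r a => by
        rw [RingHom.id_apply, smul_eq_mul, ← integral_const_mul]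
        congr 1; ext x; simp [mul_left_comm] }
  obtain ⟨p, hp⟩ := exists_riesz A L (fun w hw => by
      have h0 : (fun x => (w : Space d → ℝ) x * (w : Space d → ℝ) x) =ᵐ[μ] 0 :=
        (integral_eq_zero_iff_of_nonneg (fun x => mul_self_nonneg _) (hwi w w)).1 hw
      have : (fun x => v x * (w : Space d → ℝ) x) =ᵐ[μ] 0 := by
        filter_upwards [h0] with x hx
        have : (w : Space d → ℝ) x = 0 := mul_self_eq_zero.1 hx
        simp [this]
      exact integral_eq_zero_of_ae this)
  refine ⟨p, p.2, fun w hw => ?_⟩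
  have h := hp ⟨w, hw⟩
  have e : ∀ x, (v x - (p : Space d → ℝ) x) * w x = v x * w x - (p : Space d → ℝ) x * w x :=
    fun x => sub_mul _ _ _
  simp only [e]
  rw [integral_sub (hvi ⟨w, hw⟩) (hwi p ⟨w, hw⟩)]
  exact sub_eq_zero.2 h.symm

/-- The `L²` projection is unique up to a null set. -/
theorem IsL2Projection.ae_eq {d : ℕ} {μ : Measure (Space d)} [IsFiniteMeasure μ]
    {R : Set (Space d)} (hR : Bornology.IsBounded R) (hμ : ∀ᵐ x ∂μ, x ∈ R) {ℓ : ℕ}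
    {v p q : Space d → ℝ} (hv : Integrable v μ) (hp : IsL2Projection μ ℓ v p)
    (hq : IsL2Projection μ ℓ v q) : p =ᵐ[μ] q := by
  have hc : ∀ w ∈ polyFun d ℓ, Continuous w := fun w hw =>
    (polyFun_contDiff hw (n := 0)).continuous
  have hm := sub_mem hp.1 hq.1
  have hip := integrable_of_continuous hR hμ (hc p hp.1)
  have hiq := integrable_of_continuous hR hμ (hc q hq.1)
  have h1 := integrable_mul_continuous hR hμ (hv.sub hip) (hc _ hm)
  have h2 := integrable_mul_continuous hR hμ (hv.sub hiq) (hc _ hm)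
  have h3 := integrable_mul_continuous hR hμ (hip.sub hiq) (hc _ hm)
  have h : ∫ x, (p - q) x * (p - q) x ∂μ = 0 := by
    have e : ∀ x, (p - q) x * (p - q) x = (v - q) x * (p - q) x - (v - p) x * (p - q) x :=
      fun x => by simp only [Pi.sub_apply]; ring
    rw [integral_congr_ae (ae_of_all _ e), integral_sub h2 h1]
    have a := hp.2 _ hm
    have b := hq.2 _ hm
    simp only [Pi.sub_apply] at a b ⊢
    rw [a, b, sub_zero]
  have h0 := (integral_eq_zero_iff_of_nonneg (fun x => mul_self_nonneg _) h3).1 h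
  filter_upwards [h0] with x hx
  exact sub_eq_zero.1 (mul_self_eq_zero.1 hx)

theorem l2Projection_spec {d : ℕ} {μ : Measure (Space d)} [IsFiniteMeasure μ]
    {R : Set (Space d)} (hR : Bornology.IsBounded R) (hμ : ∀ᵐ x ∂μ, x ∈ R) (ℓ : ℕ)
    {v : Space d → ℝ} (hv : Integrable v μ) : IsL2Projection μ ℓ v (l2Projection μ ℓ v) := by
  have h := exists_isL2Projection hR hμ ℓ hv
  unfold l2Projection
  rw [dif_pos h]
  exact h.choose_spec

theorem IsPolytope.isOpen {d : ℕ} {P : Set (Space d)} (h : IsPolytope P) : IsOpen P := by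
  obtain ⟨-, S, -, rfl⟩ := h
  exact isOpen_interior

theorem IsPolytope.isBounded {d : ℕ} {P : Set (Space d)} (h : IsPolytope P) :
    Bornology.IsBounded P := by
  obtain ⟨-, S, hS, rfl⟩ := h
  refine Bornology.IsBounded.subset ?_ interior_subset
  exact (Bornology.isBounded_biUnion hS).2 fun s _ =>
    isBounded_convexHull.2 (finite_range _).isBounded

section Faces

variable {d : ℕ} {Ω : Set (Space d)} (M : PolytopalMesh Ω) {F T : Set (Space d)}

theorem PolytopalMesh.mem_facesOf : F ∈ M.facesOf T ↔ F ∈ M.faces ∧ F ⊆ frontier T := by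
  simp [PolytopalMesh.facesOf]

theorem PolytopalMesh.measurableSet_face (hF : F ∈ M.faces) : MeasurableSet F := by
  obtain ⟨H, O, -, hO, rfl⟩ := M.face_flat F hF
  exact hO.measurableSet.inter H.closed_of_finiteDimensional.measurableSet

theorem PolytopalMesh.measure_face_lt_top (hF : F ∈ M.faces) (hb : Bornology.IsBounded F) :
    (μHE[d - 1] : Measure (Space d)) F < ⊤ := by
  obtain ⟨c, hc⟩ := M.face_nonempty F hF
  obtain ⟨H, O, hd, hO, rfl⟩ := M.face_flat F hF
  obtain ⟨R, hR⟩ := hb.subset_closedBall c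
  let g : H.direction → Space d := fun v => (v : Space d) + c
  have hg : Isometry g := (IsometryEquiv.addRight c).isometry.comp isometry_subtype_coe
  have hsub : O ∩ H ⊆ g '' closedBall 0 R := by
    intro x hx
    have hxd : x - c ∈ H.direction := H.vsub_mem_direction hx.2 hc.2
    refine ⟨⟨x - c, hxd⟩, ?_, by simp [g]⟩
    have := hR hx
    rw [mem_closedBall, dist_eq_norm] at this
    simpa using this
  refine (measure_mono hsub).trans_lt ?_
  rw [hg.euclideanHausdorffMeasure_image]
  have hd' : d - 1 = Module.finrank ℝ H.direction := by omega
  rw [hd', InnerProductSpace.euclideanHausdorffMeasure_eq_volume]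
  exact measure_closedBall_lt_top

end Faces

section Potential

variable {d : ℕ} {Ω : Set (Space d)} (M : PolytopalMesh Ω) {T : Set (Space d)} {k l : ℕ}

theorem grad_add {ℓ : ℕ} {a b : Space d → ℝ} (ha : a ∈ polyFun d ℓ) (hb : b ∈ polyFun d ℓ)
    (x : Space d) : ∇ (a + b) x = ∇ a x + ∇ b x := by
  have h1 := ((polyFun_contDiff ha (n := 1)).differentiable (by simp)) x
  have h2 := ((polyFun_contDiff hb (n := 1)).differentiable (by simp)) x
  simp [gradient, fderiv_add h1 h2]

theorem grad_smul {ℓ : ℕ} {a : Space d → ℝ} (ha : a ∈ polyFun d ℓ) (r : ℝ)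
    (x : Space d) : ∇ (r • a) x = r • ∇ a x := by
  have h1 := ((polyFun_contDiff ha (n := 1)).differentiable (by simp)) x
  simp [gradient, fderiv_const_smul h1]

theorem integrableOn_bdry (hb : Bornology.IsBounded T) (v : brokenPoly (M.facesOf T) k)
    {g : Space d → Space d} (hg : Continuous g) :
    IntegrableOn (fun x => (v : Space d → ℝ) x * ⟪g x, boundaryNormal T (M.facesOf T) x⟫)
      (frontier T) (μHE[d - 1] : Measure (Space d)) := by
  have hfb : Bornology.IsBounded (frontier T) := hb.closure.subset frontier_subset_closure
  have e : (fun x => (v : Space d → ℝ) x * ⟪g x, boundaryNormal T (M.facesOf T) x⟫) =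
      fun x => ∑ F ∈ M.facesOf T,
        F.indicator (fun x => (v : Space d → ℝ) x * ⟪g x, faceNormal T F⟫) x := by
    ext x
    rw [boundaryNormal, inner_sum, Finset.mul_sum]
    refine Finset.sum_congr rfl fun F _ => ?_
    by_cases hx : x ∈ F <;> simp [hx]
  rw [e]
  refine Integrable.integrableOn (integrable_finsetSum _ fun F hF => ?_)
  obtain ⟨hFm, hFf⟩ := (M.mem_facesOf).1 hF
  obtain ⟨p, hp, hvp⟩ := v.2.2 F hF
  have hmeas := M.measurableSet_face hFm
  have hbF := hfb.subset hFf
  rw [integrable_indicator_iff hmeas]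
  have : IsFiniteMeasure ((μHE[d - 1] : Measure (Space d)).restrict F) :=
    ⟨by simpa using M.measure_face_lt_top hFm hbF⟩
  refine IntegrableOn.congr_fun (f := fun x => p x * ⟪g x, faceNormal T F⟫) ?_
    (fun x hx => by simp only [hvp hx]) hmeas
  exact integrable_of_continuous hbF (ae_restrict_mem hmeas)
    ((polyFun_contDiff hp (n := 0)).continuous.mul (hg.inner continuous_const))

theorem grad_eq_zero_of_gradInner {ℓ : ℕ} (hT : IsPolytope T) {w : Space d → ℝ}
    (hw : w ∈ polyFun d ℓ) (h : gradInner T w w = 0) : ∃ c : ℝ, w = fun _ => c := by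
  have hgc := polyFun_continuous_grad hw
  have : IsFiniteMeasure (volume.restrict T : Measure (Space d)) :=
    ⟨by simpa using hT.isBounded.measure_lt_top⟩
  have hi : Integrable (fun x => ⟪∇ w x, ∇ w x⟫) (volume.restrict T) :=
    integrable_of_continuous hT.isBounded (ae_restrict_mem hT.isOpen.measurableSet)
      (hgc.inner hgc)
  have h0 := (integral_eq_zero_iff_of_nonneg (fun x => real_inner_self_nonneg) hi).1 h
  have h1 : EqOn (fun x => ⟪∇ w x, ∇ w x⟫) 0 T :=
    Measure.eqOn_open_of_ae_eq h0 hT.isOpen (hgc.inner hgc).continuousOn continuousOn_const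
  have h2 : ∀ x ∈ T, fderiv ℝ w x = 0 := fun x hx => by
    have : ∇ w x = 0 := inner_self_eq_zero.1 (h1 hx)
    simpa [gradient] using this
  obtain ⟨x₀, hx₀⟩ := hT.1.nonempty
  have h3 : fderiv ℝ w = 0 := by
    refine AnalyticOnNhd.eq_of_eventuallyEq (z₀ := x₀) (polyFun_analytic hw).fderiv
      analyticOnNhd_const ?_
    filter_upwards [hT.isOpen.mem_nhds hx₀] with x hx using h2 x hx
  refine ⟨w 0, funext fun x => ?_⟩
  exact is_const_of_fderiv_eq_zero ((polyFun_contDiff hw (n := 1)).differentiable (by simp))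
    (fun x => by rw [h3]; rfl) x 0

/-- The potential reconstruction is unique. -/
theorem IsPotential.eq (hT : T ∈ M.elements) {v : LocalSpace (M.facesOf T) k l}
    {p q : Space d → ℝ} (hp : IsPotential T (M.facesOf T) v p)
    (hq : IsPotential T (M.facesOf T) v q) : p = q := by
  have hP := M.element_polytope T hT
  have hb := hP.isBounded
  have hR := ae_restrict_mem (μ := (volume : Measure (Space d))) hP.isOpen.measurableSet
  have : IsFiniteMeasure (volume.restrict T : Measure (Space d)) :=
    ⟨by simpa using hb.measure_lt_top⟩
  have hm := sub_mem hp.1 hq.1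
  have hadd : ∀ x, ∇ p x = ∇ (p - q) x + ∇ q x := fun x => by
    rw [← grad_add hm hq.1, sub_add_cancel]
  have hgi : ∀ w ∈ polyFun d (k + 1),
      Integrable (fun x => ⟪∇ w x, ∇ (p - q) x⟫) (volume.restrict T) := fun w hw =>
    integrable_of_continuous hb hR
      ((polyFun_continuous_grad hw).inner (polyFun_continuous_grad hm))
  have h0 : gradInner T (p - q) (p - q) = 0 := by
    have h1 : gradInner T p (p - q) = gradInner T (p - q) (p - q) + gradInner T q (p - q) := by
      simp only [gradInner]
      rw [← integral_add (hgi _ hm) (hgi _ hq.1)]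
      congr 1
      ext x
      rw [hadd, inner_add_left]
    have h2 := (hp.2.1 _ hm).trans (hq.2.1 _ hm).symm
    linarith
  obtain ⟨b, hpq⟩ := grad_eq_zero_of_gradInner hP hm h0
  have hpi : ∀ w {m : ℕ}, w ∈ polyFun d m → Integrable w (volume.restrict T) := fun w m hw =>
    integrable_of_continuous hb hR (polyFun_contDiff hw (n := 0)).continuous
  have h3 : ∫ x in T, (p - q) x = 0 := by
    have h4 := hp.2.2
    have h5 := hq.2.2
    rw [integral_sub (hpi _ v.1.2) (hpi _ hp.1)] at h4
    rw [integral_sub (hpi _ v.1.2) (hpi _ hq.1)] at h5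
    simp only [Pi.sub_apply]
    rw [integral_sub (hpi _ hp.1) (hpi _ hq.1)]
    linarith
  have hvol : (volume : Measure (Space d)).real T ≠ 0 := by
    rw [measureReal_def]
    exact (ENNReal.toReal_pos (hP.isOpen.measure_pos _ hP.1.nonempty).ne'
      hb.measure_lt_top.ne).ne'
  rw [hpq, setIntegral_const, smul_eq_mul] at h3
  have hb0 : b = 0 := (mul_eq_zero.1 h3).resolve_left hvol
  rw [hb0] at hpq
  exact sub_eq_zero.1 hpq

/-- The potential reconstruction exists. -/
theorem exists_isPotential (hT : T ∈ M.elements) (v : LocalSpace (M.facesOf T) k l) :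
    ∃ p, IsPotential T (M.facesOf T) v p := by
  have hP := M.element_polytope T hT
  have hb := hP.isBounded
  have hR := ae_restrict_mem (μ := (volume : Measure (Space d))) hP.isOpen.measurableSet
  have : IsFiniteMeasure (volume.restrict T : Measure (Space d)) :=
    ⟨by simpa using hb.measure_lt_top⟩
  set n := boundaryNormal T (M.facesOf T) with hn
  have hgc : ∀ w : polyFun d (k + 1), Continuous (∇ (w : Space d → ℝ)) := fun w =>
    polyFun_continuous_grad w.2
  have hgi : ∀ u w : polyFun d (k + 1),
      Integrable (fun x => ⟪∇ (u : Space d → ℝ) x, ∇ (w : Space d → ℝ) x⟫) (volume.restrict T) :=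
    fun u w => integrable_of_continuous hb hR ((hgc u).inner (hgc w))
  have hvc : Continuous (v.1 : Space d → ℝ) := (polyFun_contDiff v.1.2 (n := 0)).continuous
  have hli : ∀ w : polyFun d (k + 1),
      Integrable (fun x => (v.1 : Space d → ℝ) x * Δ (w : Space d → ℝ) x) (volume.restrict T) :=
    fun w => integrable_of_continuous hb hR (hvc.mul (polyFun_continuous_laplacian w.2))
  have hbi := fun w : polyFun d (k + 1) => integrableOn_bdry M hb v.2 (hgc w)
  have : FiniteDimensional ℝ (polyFun d (k + 1)) := by unfold polyFun; infer_instance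
  have gadd : ∀ (a b : polyFun d (k + 1)) x, ∇ (((a + b : polyFun d (k + 1))) : Space d → ℝ) x =
    ∇ (a : Space d → ℝ) x + ∇ (b : Space d → ℝ) x := fun a b x => grad_add a.2 b.2 x
  have gsmul : ∀ (r : ℝ) (a : polyFun d (k + 1)) x,
    ∇ (((r • a : polyFun d (k + 1))) : Space d → ℝ) x = r • ∇ (a : Space d → ℝ) x :=
    fun r a x => grad_smul a.2 r x
  have ladd : ∀ (a b : polyFun d (k + 1)) x, Δ (((a + b : polyFun d (k + 1))) : Space d → ℝ) x =
    Δ (a : Space d → ℝ) x + Δ (b : Space d → ℝ) x := fun a b x =>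
    ContDiffAt.laplacian_add (polyFun_contDiff a.2 (n := 2)).contDiffAt
      (polyFun_contDiff b.2 (n := 2)).contDiffAt
  have lsmul : ∀ (r : ℝ) (a : polyFun d (k + 1)) x,
    Δ (((r • a : polyFun d (k + 1))) : Space d → ℝ) x = r • Δ (a : Space d → ℝ) x :=
    fun r a x => InnerProductSpace.laplacian_smul r (polyFun_contDiff a.2 (n := 2)).contDiffAt
  let A : polyFun d (k + 1) →ₗ[ℝ] polyFun d (k + 1) →ₗ[ℝ] ℝ := LinearMap.mk₂ ℝ
    (fun u w => gradInner T u w)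
    (fun a b c => by
      simp only [gradInner]
      rw [← integral_add (hgi a c) (hgi b c)]; congr 1; ext x; rw [gadd, inner_add_left])
    (fun r a c => by
      simp only [gradInner]
      rw [smul_eq_mul, ← integral_const_mul]; congr 1; ext x; rw [gsmul, real_inner_smul_left])
    (fun a b c => by
      simp only [gradInner]
      rw [← integral_add (hgi a b) (hgi a c)]; congr 1; ext x; rw [gadd, inner_add_right])
    (fun r a c => by
      simp only [gradInner]
      rw [smul_eq_mul, ← integral_const_mul]; congr 1; ext x; rw [gsmul, real_inner_smul_right])
  let L : polyFun d (k + 1) →ₗ[ℝ] ℝ :=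
    { toFun := fun w => -elemInner T (v.1 : Space d → ℝ) (Δ (w : Space d → ℝ)) +
        bdryInner T (v.2 : Space d → ℝ) (fun x => ⟪∇ (w : Space d → ℝ) x, n x⟫)
      map_add' := fun a b => by
        have h1 : elemInner T (v.1 : Space d → ℝ) (Δ ((a + b : polyFun d (k + 1)) : Space d → ℝ))
            = elemInner T (v.1 : Space d → ℝ) (Δ (a : Space d → ℝ)) +
              elemInner T (v.1 : Space d → ℝ) (Δ (b : Space d → ℝ)) := by
          simp only [elemInner]
          rw [← integral_add (hli a) (hli b)]; congr 1; ext x; rw [ladd, mul_add]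
        have h2 : bdryInner T (v.2 : Space d → ℝ)
              (fun x => ⟪∇ ((a + b : polyFun d (k + 1)) : Space d → ℝ) x, n x⟫)
            = bdryInner T (v.2 : Space d → ℝ) (fun x => ⟪∇ (a : Space d → ℝ) x, n x⟫) +
              bdryInner T (v.2 : Space d → ℝ) (fun x => ⟪∇ (b : Space d → ℝ) x, n x⟫) := by
          simp only [bdryInner]
          rw [← integral_add (hbi a) (hbi b)]; congr 1; ext x
          rw [gadd, inner_add_left, mul_add]
        rw [h1, h2]; ring
      map_smul' := fun r a => by
        have h1 : elemInner T (v.1 : Space d → ℝ) (Δ ((r • a : polyFun d (k + 1)) : Space d → ℝ))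
            = r * elemInner T (v.1 : Space d → ℝ) (Δ (a : Space d → ℝ)) := by
          simp only [elemInner]
          rw [← integral_const_mul]; congr 1; ext x; rw [lsmul, smul_eq_mul, mul_left_comm]
        have h2 : bdryInner T (v.2 : Space d → ℝ)
              (fun x => ⟪∇ ((r • a : polyFun d (k + 1)) : Space d → ℝ) x, n x⟫)
            = r * bdryInner T (v.2 : Space d → ℝ) (fun x => ⟪∇ (a : Space d → ℝ) x, n x⟫) := by
          simp only [bdryInner]
          rw [← integral_const_mul]; congr 1; ext x
          rw [gsmul, real_inner_smul_left, mul_left_comm]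
        rw [h1, h2, RingHom.id_apply, smul_eq_mul]; ring }
  have hconst : ∀ c : ℝ, ∇ (fun _ : Space d => c) = 0 := fun c => by
    ext x; simp [gradient]
  obtain ⟨p, hp⟩ := exists_riesz A L (fun w hw => by
      obtain ⟨c, hc⟩ := grad_eq_zero_of_gradInner hP w.2 hw
      simp [L, elemInner, bdryInner, hc, InnerProductSpace.laplacian_const])
  have hone : (fun _ : Space d => (1 : ℝ)) ∈ polyFun d (k + 1) :=
    ⟨1, by simp [MvPolynomial.mem_restrictTotalDegree], by ext x; simp [polyEval]⟩
  have hvol : (volume : Measure (Space d)).real T ≠ 0 := by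
    rw [measureReal_def]
    exact (ENNReal.toReal_pos (hP.isOpen.measure_pos _ hP.1.nonempty).ne'
      hb.measure_lt_top.ne).ne'
  have hvi : Integrable (v.1 : Space d → ℝ) (volume.restrict T) :=
    integrable_of_continuous hb hR hvc
  have hqi : ∀ q ∈ polyFun d (k + 1), Integrable q (volume.restrict T) := fun q hq =>
    integrable_of_continuous hb hR (polyFun_contDiff hq (n := 0)).continuous
  let c : ℝ := (∫ x in T, ((v.1 : Space d → ℝ) x - (p : Space d → ℝ) x)) /
    (volume : Measure (Space d)).real T
  let q : polyFun d (k + 1) := c • ⟨_, hone⟩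
  have hq : (q : Space d → ℝ) = fun _ => c := by ext x; simp [q]
  refine ⟨(p + q : polyFun d (k + 1)), (p + q).2, fun w hw => ?_, ?_⟩
  · have h := hp ⟨w, hw⟩
    have h' : A (p + q) ⟨w, hw⟩ = A p ⟨w, hw⟩ := by
      rw [map_add, LinearMap.add_apply, add_eq_left]
      simp [A, gradInner, hq, hconst]
    exact h'.trans h
  · have e : ∀ x, (v.1 : Space d → ℝ) x - ((p + q : polyFun d (k + 1)) : Space d → ℝ) x =
        ((v.1 : Space d → ℝ) x - (p : Space d → ℝ) x) - c := fun x => by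
      rw [Submodule.coe_add, Pi.add_apply, hq]; ring
    simp only [e]
    have hi : Integrable (fun x => (v.1 : Space d → ℝ) x - (p : Space d → ℝ) x)
        (volume.restrict T) := hvi.sub (hqi _ p.2)
    rw [integral_sub hi (integrable_const c), setIntegral_const, smul_eq_mul]
    simp only [c]
    field_simp
    ring

theorem potential_spec (hT : T ∈ M.elements) (v : LocalSpace (M.facesOf T) k l) :
    IsPotential T (M.facesOf T) v (potential T (M.facesOf T) v) := by
  have h := (exists_isPotential M hT v)
  unfold potential
  rw [dif_pos h]
  exact h.choose_spec

end Potential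

end HHO

end

namespace HHO

/-! ### A Poincaré inequality on sets that are star-shaped with respect to a ball -/

section Star

open Module
open scoped ENNReal

/-! The form `a_T` equals the reduced energy plus `h_T⁻² ‖δ_T‖²` (`localForm_stab_self`), so the
lower bound already holds with constant one. For the upper bound with `v_T = 0`, the reconstruction
`p` has zero mean and `δ_T` is, up to the choice of projection, the `L²` projection of `p`.
Projection is a contraction, so a Poincaré inequality `‖p‖_T ≤ c h_T ‖∇p‖_T` suffices. It is proved
for all `C¹` functions, hence no polynomial degree can enter the constant.

The difficulty is to make that constant depend on `d` and `ϱ` alone (`exists_poincare_const`),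
although the number of star-shaped pieces is unbounded. On one piece `D`, star-shaped about a ball
`B`, the difference `p x - p y` is integrated along segments and averaged over `x ∈ D`, `y ∈ B`
(`lintegral_segments_le`). The chain condition forces every piece to have diameter comparable to
that of `T` (`min_mul_diam_le_of_chain`), so every piece contains a ball of radius comparable to
`diam T` around a point of a fixed finite net. Pieces sharing a net point are star-shaped about a
common ball, and so is their union. This leaves at most as many sets as net points. The large
overlaps compare the Poincaré constants of consecutive unions, and a path without repetition
(`abs_sub_le_of_reflTransGen`) links any two in a controlled number of steps. -/

/-- The variance of `g` on the unit interval is nonnegative. -/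
theorem sq_integral_le {g : ℝ → ℝ} (hg : Continuous g) :
    (∫ t in (0 : ℝ)..1, g t) ^ 2 ≤ ∫ t in (0 : ℝ)..1, g t ^ 2 := by
  set m := ∫ t in (0 : ℝ)..1, g t
  have h : 0 ≤ ∫ t in (0 : ℝ)..1, (g t - m) ^ 2 :=
    intervalIntegral.integral_nonneg zero_le_one fun t _ => sq_nonneg _
  have e : ∫ t in (0 : ℝ)..1, (g t - m) ^ 2 =
      (∫ t in (0 : ℝ)..1, g t ^ 2) - m ^ 2 := by
    have e1 : ∀ t, (g t - m) ^ 2 = g t ^ 2 - 2 * m * g t + m ^ 2 := fun t => by ring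
    simp only [e1]
    rw [intervalIntegral.integral_add
        (Continuous.intervalIntegrable (by fun_prop) _ _) (by simp),
      intervalIntegral.integral_sub (Continuous.intervalIntegrable (by fun_prop) _ _)
        (Continuous.intervalIntegrable (by fun_prop) _ _), intervalIntegral.integral_const_mul]
    simp only [intervalIntegral.integral_const, smul_eq_mul]
    change _ - 2 * m * m + _ = _
    ring
  linarith

/-- The fundamental theorem of calculus along the segment from `y` to `x`, followed by
`sq_integral_le`. -/
theorem sq_sub_le_integral_segment {E : Type*} [NormedAddCommGroup E] [NormedSpace ℝ E]
    {p : E → ℝ} (hp : ContDiff ℝ 1 p) (x y : E) :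
    (p x - p y) ^ 2 ≤
      ‖x - y‖ ^ 2 * ∫ t in (0 : ℝ)..1, ‖fderiv ℝ p ((1 - t) • y + t • x)‖ ^ 2 := by
  have hd := hp.differentiable (by simp)
  have hc := hp.continuous_fderiv (by simp)
  have hγ : ∀ t : ℝ, HasDerivAt (fun t : ℝ => p ((1 - t) • y + t • x))
      (fderiv ℝ p ((1 - t) • y + t • x) (x - y)) t := fun t => by
    refine (hd _).hasFDerivAt.comp_hasDerivAt t ?_
    have h1 : HasDerivAt (fun t : ℝ => (1 - t) • y) ((-1 : ℝ) • y) t :=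
      ((hasDerivAt_id t).const_sub 1).smul_const y
    have h2 : HasDerivAt (fun t : ℝ => t • x) ((1 : ℝ) • x) t :=
      (hasDerivAt_id t).smul_const x
    have h3 : (-1 : ℝ) • y + (1 : ℝ) • x = x - y := by module
    exact h3 ▸ h1.add h2
  have hcont : Continuous fun t : ℝ => fderiv ℝ p ((1 - t) • y + t • x) := by fun_prop
  have hcont' : Continuous fun t : ℝ => fderiv ℝ p ((1 - t) • y + t • x) (x - y) := by fun_prop
  have h := intervalIntegral.integral_eq_sub_of_hasDerivAt (fun t _ => hγ t)
    (hcont'.intervalIntegrable 0 1)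
  simp only [sub_self, zero_smul, one_smul, zero_add, sub_zero, add_zero] at h
  rw [← h, ← intervalIntegral.integral_const_mul]
  refine (sq_integral_le hcont').trans ?_
  refine intervalIntegral.integral_mono_on zero_le_one
    (Continuous.intervalIntegrable (by fun_prop) _ _)
    (Continuous.intervalIntegrable (by fun_prop) _ _) fun t _ => ?_
  rw [← mul_pow, ← sq_abs, ← Real.norm_eq_abs]
  have := (fderiv ℝ p ((1 - t) • y + t • x)).le_opNorm (x - y)
  gcongr
  linarith

/-! ### Averages over the segments issuing from a set of star centres. -/

variable {E : Type*} [NormedAddCommGroup E] [NormedSpace ℝ E] [FiniteDimensional ℝ E]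
  [MeasurableSpace E] [BorelSpace E] (μ : Measure E) [μ.IsAddHaarMeasure]

/-- A dilation by `c` has inverse Jacobian `c⁻ⁿ`, at most `2ⁿ` here. Inserting the indicator of `D`
allows the integral to be extended to the whole space, where the translation by `w` is harmless. -/
theorem setLIntegral_comp_affine_le {f : E → ℝ≥0∞} (hf : Measurable f) {A D : Set E}
    (hA : MeasurableSet A) (hD : MeasurableSet D) {c : ℝ} (hc : 1 / 2 ≤ c) (w : E)
    (hAD : ∀ x ∈ A, c • x + w ∈ D) :
    ∫⁻ x in A, f (c • x + w) ∂μ ≤ 2 ^ finrank ℝ E * ∫⁻ x in D, f x ∂μ := by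
  have hc0 : 0 < c := by linarith
  have hg : Measurable fun x => D.indicator f (x + w) :=
    (hf.indicator hD).comp (measurable_add_const w)
  calc ∫⁻ x in A, f (c • x + w) ∂μ
      = ∫⁻ x in A, D.indicator f (c • x + w) ∂μ :=
        setLIntegral_congr_fun hA fun x hx => by simp [hAD x hx]
    _ ≤ ∫⁻ x, D.indicator f (c • x + w) ∂μ := setLIntegral_le_lintegral _ _
    _ = ∫⁻ x, D.indicator f (x + w) ∂(μ.map (c • ·)) :=
        (lintegral_map hg (measurable_const_smul c)).symm
    _ = ENNReal.ofReal |(c ^ finrank ℝ E)⁻¹| * ∫⁻ x, D.indicator f (x + w) ∂μ := by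
        rw [Measure.map_addHaar_smul μ hc0.ne', lintegral_smul_measure, smul_eq_mul]
    _ = ENNReal.ofReal |(c ^ finrank ℝ E)⁻¹| * ∫⁻ x in D, f x ∂μ := by
        rw [lintegral_add_right_eq_self (fun x => D.indicator f x), lintegral_indicator hD]
    _ ≤ 2 ^ finrank ℝ E * ∫⁻ x in D, f x ∂μ := by
        gcongr
        rw [abs_of_pos (by positivity), ← inv_pow, ENNReal.ofReal_pow (by positivity)]
        gcongr
        rw [ENNReal.ofReal_le_iff_le_toReal (by simp)]
        rw [ENNReal.toReal_ofNat, inv_le_comm₀ hc0 (by norm_num)]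
        linarith

/-- For fixed `t` one of the weights `t`, `1 - t` is at least `1/2`. Changing variables in the
endpoint that carries this weight keeps the Jacobian bounded, whereas using `x` throughout would
give the factor `t⁻ⁿ`, not integrable at zero for `n ≥ 1`. -/
theorem lintegral_segments_le {f : E → ℝ≥0∞} (hf : Measurable f) {B D : Set E}
    (hB : MeasurableSet B) (hD : MeasurableSet D) (hBD : B ⊆ D)
    (hstar : ∀ y ∈ B, StarConvex ℝ y D) :
    ∫⁻ y in B, ∫⁻ x in D, ∫⁻ t in Icc (0 : ℝ) 1, f ((1 - t) • y + t • x) ∂volume ∂μ ∂μ ≤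
      2 ^ finrank ℝ E * μ D * ∫⁻ x in D, f x ∂μ := by
  set K := 2 ^ finrank ℝ E * μ D * ∫⁻ x in D, f x ∂μ
  have hseg : ∀ t ∈ Icc (0 : ℝ) 1, ∀ y ∈ B, ∀ x ∈ D, (1 - t) • y + t • x ∈ D :=
    fun t ht y hy x hx => hstar y hy hx (by linarith [ht.2]) ht.1 (by ring)
  have hm3 : Measurable fun q : (E × E) × ℝ => f ((1 - q.2) • q.1.1 + q.2 • q.1.2) :=
    hf.comp (by fun_prop)
  have hm3' : Measurable fun q : (E × ℝ) × E => f ((1 - q.1.2) • q.1.1 + q.1.2 • q.2) :=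
    hf.comp (by fun_prop)
  have hkey : ∀ t ∈ Icc (0 : ℝ) 1,
      ∫⁻ y in B, ∫⁻ x in D, f ((1 - t) • y + t • x) ∂μ ∂μ ≤ K := by
    intro t ht
    rcases le_total (1 / 2) t with h | h
    · calc ∫⁻ y in B, ∫⁻ x in D, f ((1 - t) • y + t • x) ∂μ ∂μ
          ≤ ∫⁻ _ in B, 2 ^ finrank ℝ E * ∫⁻ x in D, f x ∂μ ∂μ := by
            refine setLIntegral_mono' hB fun y hy => ?_
            simp only [add_comm ((1 - t) • y)]
            exact setLIntegral_comp_affine_le μ hf hD hD h _ fun x hx => by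
              rw [add_comm]; exact hseg t ht y hy x hx
        _ ≤ K := by
            rw [setLIntegral_const, mul_right_comm]
            exact mul_le_mul_left (mul_le_mul_right (measure_mono hBD) _) _
    · have hm : Measurable fun q : E × E => f ((1 - t) • q.1 + t • q.2) := hf.comp (by fun_prop)
      calc ∫⁻ y in B, ∫⁻ x in D, f ((1 - t) • y + t • x) ∂μ ∂μ
          = ∫⁻ x in D, ∫⁻ y in B, f ((1 - t) • y + t • x) ∂μ ∂μ :=
            lintegral_lintegral_swap hm.aemeasurable
        _ ≤ ∫⁻ _ in D, 2 ^ finrank ℝ E * ∫⁻ x in D, f x ∂μ ∂μ := by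
            refine setLIntegral_mono' hD fun x hx => ?_
            exact setLIntegral_comp_affine_le μ hf hB hD (by linarith) _ fun y hy =>
              hseg t ht y hy x hx
        _ = K := by rw [setLIntegral_const, mul_right_comm]
  calc ∫⁻ y in B, ∫⁻ x in D, ∫⁻ t in Icc (0 : ℝ) 1, f ((1 - t) • y + t • x) ∂volume ∂μ ∂μ
      = ∫⁻ y in B, ∫⁻ t in Icc (0 : ℝ) 1, ∫⁻ x in D, f ((1 - t) • y + t • x) ∂μ ∂volume ∂μ := by
        refine lintegral_congr fun y => lintegral_lintegral_swap ?_
        exact (hf.comp (by fun_prop : Measurable fun q : E × ℝ =>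
          (1 - q.2) • y + q.2 • q.1)).aemeasurable
    _ = ∫⁻ t in Icc (0 : ℝ) 1, ∫⁻ y in B, ∫⁻ x in D, f ((1 - t) • y + t • x) ∂μ ∂μ ∂volume :=
        lintegral_lintegral_swap hm3'.lintegral_prod_right'.aemeasurable
    _ ≤ ∫⁻ _ in Icc (0 : ℝ) 1, K ∂volume := setLIntegral_mono' measurableSet_Icc hkey
    _ = K := by simp

/-- Poincaré inequality on a bounded set that is star-shaped with respect to each point of `B`. -/
theorem exists_lintegral_sq_sub_le {p : E → ℝ} (hp : ContDiff ℝ 1 p) {B D : Set E}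
    (hB : MeasurableSet B) (hD : MeasurableSet D) (hBD : B ⊆ D)
    (hstar : ∀ y ∈ B, StarConvex ℝ y D) (hB0 : μ B ≠ 0) {h : ℝ} (hB1 : μ B ≠ ⊤)
    (hdiam : ∀ x ∈ D, ∀ y ∈ D, dist x y ≤ h) :
    ∃ a : ℝ, ∫⁻ x in D, ENNReal.ofReal ((p x - a) ^ 2) ∂μ ≤
      2 ^ finrank ℝ E * μ D / μ B * ENNReal.ofReal (h ^ 2) *
        ∫⁻ x in D, ENNReal.ofReal (‖fderiv ℝ p x‖ ^ 2) ∂μ := by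
  have hc := hp.continuous_fderiv (by simp)
  have hpc := hp.continuous
  set f : E → ℝ≥0∞ := fun x => ENNReal.ofReal (‖fderiv ℝ p x‖ ^ 2) with hf
  have hfm : Measurable f := by
    refine ENNReal.measurable_ofReal.comp (Continuous.measurable ?_)
    fun_prop
  have hm2 : Measurable fun q : E × E => ENNReal.ofReal ((p q.2 - p q.1) ^ 2) := by
    refine ENNReal.measurable_ofReal.comp (Continuous.measurable ?_)
    fun_prop
  have hm3 : Measurable fun q : (E × E) × ℝ => f ((1 - q.2) • q.1.1 + q.2 • q.1.2) :=
    hfm.comp (by fun_prop)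
  have hpt : ∀ y ∈ D, ∀ x ∈ D, ENNReal.ofReal ((p x - p y) ^ 2) ≤
      ENNReal.ofReal (h ^ 2) * ∫⁻ t in Icc (0 : ℝ) 1, f ((1 - t) • y + t • x) := by
    intro y hy x hx
    have hcont : Continuous fun t : ℝ => ‖fderiv ℝ p ((1 - t) • y + t • x)‖ ^ 2 := by fun_prop
    rw [hf, ← ofReal_integral_eq_lintegral_ofReal hcont.integrableOn_Icc
      (ae_of_all _ fun t => by positivity), ← ENNReal.ofReal_mul (by positivity),
      integral_Icc_eq_integral_Ioc, ← intervalIntegral.integral_of_le zero_le_one]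
    refine ENNReal.ofReal_le_ofReal ((sq_sub_le_integral_segment hp x y).trans ?_)
    have hn : 0 ≤ ∫ t in (0 : ℝ)..1, ‖fderiv ℝ p ((1 - t) • y + t • x)‖ ^ 2 :=
      intervalIntegral.integral_nonneg zero_le_one fun t _ => by positivity
    have := hdiam x hx y hy
    rw [dist_eq_norm] at this
    gcongr
  -- Some `y ∈ B` does no worse than the average over `B`; the constant is the value of `p` there.
  obtain ⟨y, hy, hya⟩ := exists_le_setLAverage (μ := μ) (s := B)
    (f := fun y => ∫⁻ x in D, ENNReal.ofReal ((p x - p y) ^ 2) ∂μ) hB0 hB1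
    hm2.lintegral_prod_right'.aemeasurable
  refine ⟨p y, hya.trans ?_⟩
  rw [setLAverage_eq]
  have hI : ∫⁻ y in B, ∫⁻ x in D, ENNReal.ofReal ((p x - p y) ^ 2) ∂μ ∂μ ≤
      ENNReal.ofReal (h ^ 2) * (2 ^ finrank ℝ E * μ D * ∫⁻ x in D, f x ∂μ) :=
    calc ∫⁻ y in B, ∫⁻ x in D, ENNReal.ofReal ((p x - p y) ^ 2) ∂μ ∂μ
        ≤ ∫⁻ y in B, ENNReal.ofReal (h ^ 2) * ∫⁻ x in D,
            ∫⁻ t in Icc (0 : ℝ) 1, f ((1 - t) • y + t • x) ∂volume ∂μ ∂μ := by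
          refine setLIntegral_mono' hB fun y hy => ?_
          rw [← lintegral_const_mul' _ _ ENNReal.ofReal_ne_top]
          exact setLIntegral_mono' hD fun x hx => hpt y (hBD hy) x hx
      _ ≤ _ := by
          rw [lintegral_const_mul' _ _ ENNReal.ofReal_ne_top]
          gcongr
          exact lintegral_segments_le μ hfm hB hD hBD hstar
  calc _ ≤ ENNReal.ofReal (h ^ 2) * (2 ^ finrank ℝ E * μ D * ∫⁻ x in D, f x ∂μ) / μ B := by
        gcongr
    _ = _ := by
        simp only [div_eq_mul_inv]
        ring

end Star

end HHO

namespace HHO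

/-! ### A Poincaré inequality on sets connected by star-shaped sets -/

/-- A chain may be arbitrarily long, but in the associated simple graph it can be shortened to a
path, which visits each vertex at most once and so has fewer steps than there are vertices. -/
theorem abs_sub_le_of_reflTransGen {ι : Type*} [Fintype ι] {r : ι → ι → Prop} {f : ι → ℝ} {δ : ℝ}
    (hδ : 0 ≤ δ) (hr : ∀ a b, r a b → |f a - f b| ≤ δ) {a b : ι} (h : Relation.ReflTransGen r a b) :
    |f a - f b| ≤ Fintype.card ι * δ := by
  classical
  have hadj : ∀ {a b}, (SimpleGraph.fromRel r).Adj a b → |f a - f b| ≤ δ := by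
    intro a b hab
    rcases ((SimpleGraph.fromRel_adj r a b).1 hab).2 with h | h
    · exact hr _ _ h
    · rw [abs_sub_comm]; exact hr _ _ h
  have hwalk : ∀ {a b} (w : (SimpleGraph.fromRel r).Walk a b), |f a - f b| ≤ w.length * δ := by
    intro a b w
    induction w with
    | nil => simp
    | cons hab w ih =>
      have := abs_sub_le (f _) (f _) (f _) |>.trans (add_le_add (hadj hab) ih)
      rw [SimpleGraph.Walk.length_cons]
      push_cast
      linarith
  have hreach : (SimpleGraph.fromRel r).Reachable a b := by
    induction h with
    | refl => exact .refl _
    | @tail b c _ hbc ih =>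
      by_cases hne : b = c
      · exact hne ▸ ih
      · exact ih.trans ((SimpleGraph.fromRel_adj r b c).2 ⟨hne, .inl hbc⟩).reachable
  obtain ⟨w⟩ := hreach
  have hlt := w.toPath.2.length_lt
  refine (hwalk w.toPath.1).trans ?_
  gcongr

/-- Overlaps only count a nonnegative integrand several times. -/
theorem setIntegral_iUnion_le {X ι : Type*} [MeasurableSpace X] [Fintype ι] {μ : Measure X}
    {W : ι → Set X} {f : X → ℝ} (hf : ∀ i, IntegrableOn f (W i) μ) (hf0 : ∀ x, 0 ≤ f x) :
    ∫ x in ⋃ i, W i, f x ∂μ ≤ ∑ i, ∫ x in W i, f x ∂μ := by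
  rw [← integral_finsetSum_measure fun i _ => hf i, ← Measure.sum_fintype]
  refine integral_mono_measure Measure.restrict_iUnion_le (ae_of_all _ hf0) ?_
  rw [Measure.sum_fintype]
  exact integrable_finsetSum_measure.2 fun i _ => hf i

/-! ### Comparison of diameters and volumes, and gluing of local Poincaré inequalities. -/

section Geometry

variable {d : ℕ}

theorem integrableOn_of_continuous {W : Set (Space d)} (hb : Bornology.IsBounded W)
    {f : Space d → ℝ} (hf : Continuous f) : IntegrableOn f W :=
  (hf.continuousOn.integrableOn_compact hb.isCompact_closure).mono_set subset_closure

/-- The set lies in the closed ball of radius `diam W` about any of its points, and spheres are null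
in positive dimension. -/
theorem volume_le_volume_ball_diam [NeZero d] {W : Set (Space d)} (hb : Bornology.IsBounded W) :
    volume W ≤ volume (ball (0 : Space d) (diam W)) := by
  rcases W.eq_empty_or_nonempty with rfl | ⟨g, hg⟩
  · simp
  have h : W ⊆ closedBall g (diam W) := fun x hx => dist_le_diam_of_mem hb hx hg
  refine (measure_mono h).trans_eq ?_
  rw [Measure.addHaar_closedBall_eq_addHaar_ball, Measure.addHaar_ball_center]

theorem volumeReal_ball_mul (c : Space d) {s h : ℝ} (hs : 0 < s) :
    volume.real (ball c (s * h)) = s ^ d * volume.real (ball (0 : Space d) h) := by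
  rw [measureReal_def, Measure.addHaar_ball_mul_of_pos _ _ hs, ENNReal.toReal_mul,
    ENNReal.toReal_ofReal (by positivity), finrank_euclideanSpace_fin, measureReal_def]

/-- The sets of a star-shaped covering have a diameter comparable to that of their union. -/
theorem min_mul_diam_le_of_chain [NeZero d] {ϱ : ℝ} {N : ℕ} {U : Set (Space d)}
    {V : Fin N → Set (Space d)} (hb : Bornology.IsBounded U) (hU : U = ⋃ i, V i)
    (hchain : ∀ i j, Relation.ReflTransGen
      (fun a b => volume (ball (0 : Space d) (ϱ * diam U)) ≤ volume (V a ∩ V b)) i j) (i : Fin N) :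
    min 1 ϱ * diam U ≤ diam (V i) := by
  have hsub : V i ⊆ U := hU ▸ subset_iUnion V i
  by_cases h : ∃ j, j ≠ i
  · obtain ⟨j, hj⟩ := h
    -- The first step of a chain leaving `i` shows that `V i` itself has at least the volume of a
    -- ball of radius `ϱ * diam U`; comparison with the ball of radius `diam (V i)` gives the bound.
    obtain ⟨a, ha, -⟩ := (Relation.ReflTransGen.cases_head (hchain i j)).resolve_left hj.symm
    have h1 := ha.trans ((measure_mono inter_subset_left).trans
      (volume_le_volume_ball_diam (hb.subset hsub)))
    have h2 : ϱ * diam U ≤ diam (V i) := by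
      by_contra! hlt
      have h0 : 0 < ϱ * diam U := diam_nonneg.trans_lt hlt
      rw [Measure.addHaar_ball _ _ h0.le, Measure.addHaar_ball _ _ diam_nonneg,
        ENNReal.mul_le_mul_iff_left (measure_ball_pos _ _ one_pos).ne' measure_ball_lt_top.ne,
        ENNReal.ofReal_le_ofReal_iff (by positivity)] at h1
      exact (pow_lt_pow_left₀ hlt diam_nonneg (by simp [NeZero.ne])).not_ge h1
    exact (mul_le_mul_of_nonneg_right (min_le_right _ _) diam_nonneg).trans h2
  · push Not at h
    have : V i = U := by
      rw [hU]
      exact (subset_iUnion V i).antisymm (iUnion_subset fun j => by rw [h j])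
    rw [this]
    exact mul_le_of_le_one_left diam_nonneg (min_le_left _ _)

/-- The star-shaped inequality rescaled to the ambient `T`: volumes, diameters and the gradient are
measured on `T`, so all pieces of a covering share the same right-hand side. -/
theorem exists_integral_sq_sub_le [NeZero d] {W T : Set (Space d)} (hW : IsOpen W)
    (hWT : W ⊆ T) (hb : Bornology.IsBounded T) {g : Space d} {s : ℝ} (hs : 0 < s)
    (hT : 0 < diam T)
    (hball : ball g (s * diam T) ⊆ W) (hstar : ∀ y ∈ ball g (s * diam T), StarConvex ℝ y W)
    {p : Space d → ℝ} (hp : ContDiff ℝ 1 p) :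
    ∃ a : ℝ, ∫ x in W, (p x - a) ^ 2 ≤
      2 ^ d * (s ^ d)⁻¹ * (diam T ^ 2 * ∫ x in T, ‖fderiv ℝ p x‖ ^ 2) := by
  have hc := hp.continuous_fderiv (by simp)
  have hpc := hp.continuous
  have hbW := hb.subset hWT
  obtain ⟨a, ha⟩ := exists_lintegral_sq_sub_le volume hp measurableSet_ball hW.measurableSet
    hball hstar (measure_ball_pos _ _ (by positivity)).ne' (h := diam T)
    measure_ball_lt_top.ne fun x hx y hy => dist_le_diam_of_mem hb (hWT hx) (hWT hy)
  refine ⟨a, ?_⟩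
  have hi2 : ∀ {S : Set (Space d)}, Bornology.IsBounded S →
      IntegrableOn (fun x => ‖fderiv ℝ p x‖ ^ 2) S := fun hS =>
    integrableOn_of_continuous hS (by fun_prop)
  rw [← ofReal_integral_eq_lintegral_ofReal (hi2 hbW) (ae_of_all _ fun x => by positivity),
    ← ofReal_integral_eq_lintegral_ofReal (integrableOn_of_continuous hbW (by fun_prop))
      (ae_of_all _ fun x => by positivity), finrank_euclideanSpace_fin] at ha
  have hratio : volume W / volume (ball g (s * diam T)) ≤ ENNReal.ofReal ((s ^ d)⁻¹) := by
    rw [Measure.addHaar_ball_mul_of_pos _ _ hs, finrank_euclideanSpace_fin,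
      ENNReal.ofReal_inv_of_pos (by positivity)]
    have h0 := (measure_ball_pos volume (0 : Space d) hT).ne'
    have h1 := (measure_ball_lt_top (μ := volume) (x := (0 : Space d)) (r := diam T)).ne
    refine ENNReal.div_le_of_le_mul ?_
    rw [← mul_assoc, ENNReal.inv_mul_cancel (by simp; positivity) (by simp), one_mul]
    exact (measure_mono hWT).trans (volume_le_volume_ball_diam hb)
  have h2 : (2 : ENNReal) ^ d = ENNReal.ofReal (2 ^ d) := by
    rw [ENNReal.ofReal_pow (by norm_num)]; simp
  have hmono : ∫ x in W, ‖fderiv ℝ p x‖ ^ 2 ≤ ∫ x in T, ‖fderiv ℝ p x‖ ^ 2 :=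
    setIntegral_mono_set (hi2 hb) (ae_of_all _ fun x => by positivity) hWT.eventuallyLE
  have hn : 0 ≤ ∫ x in T, ‖fderiv ℝ p x‖ ^ 2 := integral_nonneg fun x => by positivity
  refine (ENNReal.ofReal_le_ofReal_iff (by positivity)).1 (ha.trans ?_)
  rw [ENNReal.ofReal_mul (by positivity), ENNReal.ofReal_mul (by positivity),
    ENNReal.ofReal_mul (by positivity), mul_div_assoc, h2, mul_assoc _ (ENNReal.ofReal (_ ^ 2))]
  gcongr

/-- Poincaré inequality on the sets connected by star-shaped sets, with a constant that depends on
the dimension and on the parameter only. -/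
theorem exists_poincare_const (d : ℕ) [NeZero d] {ϱ : ℝ} (hϱ : 0 < ϱ) :
    ∃ K : ℝ, 0 < K ∧ ∀ T : Set (Space d), ConnectedByStarShaped ϱ T → ∀ p : Space d → ℝ,
      ContDiff ℝ 1 p → ∃ a : ℝ, ∫ x in T, (p x - a) ^ 2 ≤
        K * (diam T ^ 2 * ∫ x in T, ‖fderiv ℝ p x‖ ^ 2) := by
  -- Every piece contains a ball of radius at least `2 * s * diam T`; half of it is sacrificed to
  -- move the centre to a net point.
  set s : ℝ := ϱ * min 1 ϱ / 2 with hs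
  have hs0 : 0 < s := by positivity
  obtain ⟨t, -, htf, ht⟩ := (isCompact_closedBall (0 : Space d) 1).finite_cover_balls hs0
  have := htf.fintype
  set m : ℝ := (Fintype.card t : ℝ)
  set K₁ : ℝ := 2 ^ d * (s ^ d)⁻¹ with hK₁
  -- One factor `m` sums over the grouped sets, and `m ^ 2` is the squared path length. The summand
  -- `1` gives positivity without having to show that the net is nonempty.
  refine ⟨m * (2 * K₁ + 8 * m ^ 2 * K₁ * (ϱ ^ d)⁻¹) + 1, by positivity, ?_⟩
  rintro T ⟨hTo, hb, N, V, hVo, hU, hV, hchain⟩ p hp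
  have hpc := hp.continuous
  set G := diam T ^ 2 * ∫ x in T, ‖fderiv ℝ p x‖ ^ 2 with hG
  have hG0 : 0 ≤ G := mul_nonneg (by positivity) (integral_nonneg fun x => by positivity)
  rcases T.eq_empty_or_nonempty with rfl | ⟨x₀, hx₀⟩
  · exact ⟨0, by simpa using mul_nonneg (by positivity) hG0⟩
  have hT : 0 < diam T := by
    obtain ⟨r, hr, hrT⟩ := Metric.isOpen_iff.1 hTo x₀ hx₀
    have h1 := (measure_ball_pos volume x₀ hr).trans_le
      ((measure_mono hrT).trans (volume_le_volume_ball_diam hb))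
    by_contra! h
    rw [ball_eq_empty.2 h] at h1
    simp at h1
  choose c hcV hcstar using hV
  have hsub : ∀ i, V i ⊆ T := fun i => hU ▸ subset_iUnion V i
  have hdiam := min_mul_diam_le_of_chain hb hU hchain
  have hrad : ∀ i, 2 * s * diam T ≤ ϱ * diam (V i) := fun i => by
    have := mul_le_mul_of_nonneg_left (hdiam i) hϱ.le
    rw [hs]; linarith
  have hcT : ∀ i, c i ∈ T := fun i => hsub i (hcV i (mem_ball_self
    ((by positivity : 0 < 2 * s * diam T).trans_le (hrad i))))
  -- Centres, translated by `x₀` and scaled by `diam T`, lie in the unit ball and are rounded to the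
  -- net `t`, which was chosen before `T`.
  have hγ : ∀ i, ∃ g : t, dist (c i) (x₀ + diam T • (g : Space d)) < s * diam T := by
    intro i
    have h1 : (diam T)⁻¹ • (c i - x₀) ∈ closedBall (0 : Space d) 1 := by
      rw [mem_closedBall_zero_iff, norm_smul, norm_inv, Real.norm_of_nonneg hT.le,
        inv_mul_le_one₀ hT, ← dist_eq_norm]
      exact dist_le_diam_of_mem hb (hcT i) hx₀
    obtain ⟨g, hg, hgd⟩ := mem_iUnion₂.1 (ht h1)
    refine ⟨⟨g, hg⟩, ?_⟩
    have h2 : c i - (x₀ + diam T • g) = diam T • ((diam T)⁻¹ • (c i - x₀) - g) := by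
      rw [smul_sub, smul_inv_smul₀ hT.ne']; abel
    rw [mem_ball, dist_eq_norm] at hgd
    rw [dist_eq_norm, h2, norm_smul, Real.norm_of_nonneg hT.le, mul_comm s]
    gcongr
  choose γ hγ using hγ
  have hballs : ∀ i, ball (x₀ + diam T • (γ i : Space d)) (s * diam T) ⊆
      ball (c i) (ϱ * diam (V i)) := fun i => by
    refine ball_subset_ball' ?_
    have := hγ i
    rw [dist_comm] at this
    linarith [hrad i]
  -- Pieces with the same net point are merged. They are star-shaped about each point of one common
  -- ball, a property that passes to unions, so the number `N` of pieces disappears.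
  let W : t → Set (Space d) := fun g => ⋃ i, ⋃ (_ : γ i = g), V i
  have hWT : ∀ g, W g ⊆ T := fun g => iUnion₂_subset fun i _ => hsub i
  have hVW : ∀ i, V i ⊆ W (γ i) := fun i => subset_iUnion₂_of_subset i rfl subset_rfl
  have hWo : ∀ g, IsOpen (W g) := fun g => isOpen_iUnion fun i => isOpen_iUnion fun _ => hVo i
  have hTW : T = ⋃ g, W g := by
    refine Subset.antisymm ?_ (iUnion_subset hWT)
    rw [hU]
    exact iUnion_subset fun i => (hVW i).trans (subset_iUnion W _)
  have hA : ∀ g, ∃ a : ℝ, ∫ x in W g, (p x - a) ^ 2 ≤ K₁ * G := by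
    intro g
    -- A net point that no centre is rounded to gives an empty set, which contains no ball.
    rcases (W g).eq_empty_or_nonempty with h | ⟨x, hx⟩
    · exact ⟨0, by rw [h]; simp; positivity⟩
    obtain ⟨i, rfl, -⟩ := mem_iUnion₂.1 hx
    refine exists_integral_sq_sub_le (hWo _) (hWT _) hb hs0 hT
      (g := x₀ + diam T • (γ i : Space d)) ((hballs i).trans ((hcV i).trans (hVW i)))
      (fun y hy => starConvex_iUnion₂ fun j hj => hcstar j y (hballs j (hj ▸ hy))) hp
  choose A hA using hA
  have hint : ∀ {S : Set (Space d)}, S ⊆ T → ∀ {f : Space d → ℝ}, Continuous f →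
      IntegrableOn f S := fun hS _ hf => integrableOn_of_continuous (hb.subset hS) hf
  set β := volume.real (ball (0 : Space d) (ϱ * diam T)) with hβ
  have hβ0 : 0 < β := ENNReal.toReal_pos (measure_ball_pos _ _ (by positivity)).ne'
    measure_ball_lt_top.ne
  -- On an overlap of volume at least `β`, both constants are close to `p` in `L²`, which yields `β
  -- * (A g - A g') ^ 2 ≤ 4 * K₁ * G`.
  set δ := √(4 * K₁ * G / β) with hδ
  have hδ2 : δ ^ 2 = 4 * K₁ * G / β := Real.sq_sqrt (by positivity)
  have hstep : ∀ g g', volume (ball (0 : Space d) (ϱ * diam T)) ≤ volume (W g ∩ W g') →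
      |A g - A g'| ≤ δ := by
    intro g g' hgg
    have hI : W g ∩ W g' ⊆ T := inter_subset_left.trans (hWT g)
    have h1 : β ≤ volume.real (W g ∩ W g') :=
      ENNReal.toReal_mono (hb.subset hI).measure_lt_top.ne hgg
    have h2 : volume.real (W g ∩ W g') * (A g - A g') ^ 2 ≤ 4 * K₁ * G :=
      calc volume.real (W g ∩ W g') * (A g - A g') ^ 2
          = ∫ x in W g ∩ W g', (A g - A g') ^ 2 := by rw [setIntegral_const, smul_eq_mul]
        _ ≤ ∫ x in W g ∩ W g', (2 * (p x - A g) ^ 2 + 2 * (p x - A g') ^ 2) :=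
            setIntegral_mono (hint hI (by fun_prop)) (hint hI (by fun_prop)) fun x => by
              simp only
              nlinarith [sq_nonneg ((p x - A g) + (p x - A g'))]
        _ = 2 * (∫ x in W g ∩ W g', (p x - A g) ^ 2) +
              2 * ∫ x in W g ∩ W g', (p x - A g') ^ 2 := by
            rw [integral_add (hint hI (by fun_prop)) (hint hI (by fun_prop)),
              integral_const_mul, integral_const_mul]
        _ ≤ 2 * (∫ x in W g, (p x - A g) ^ 2) + 2 * ∫ x in W g', (p x - A g') ^ 2 := by
            gcongr
            · exact ae_of_all _ fun x => by positivity
            · exact hint (hWT _) (by fun_prop)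
            · exact inter_subset_left
            · exact ae_of_all _ fun x => by positivity
            · exact hint (hWT _) (by fun_prop)
            · exact inter_subset_right
        _ ≤ 4 * K₁ * G := by linarith [hA g, hA g']
    refine Real.abs_le_sqrt ?_
    rw [le_div_iff₀ hβ0, mul_comm]
    exact (mul_le_mul_of_nonneg_right h1 (sq_nonneg _)).trans h2
  obtain ⟨i₀, -⟩ := mem_iUnion.1 (hU ▸ hx₀)
  refine ⟨A (γ i₀), ?_⟩
  -- Chains of pieces map under `γ` to chains of merged sets, whose overlaps are no smaller; the
  -- path bound now counts net points and not pieces.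
  have hall : ∀ i, |A (γ i) - A (γ i₀)| ≤ m * δ := fun i =>
    abs_sub_le_of_reflTransGen (Real.sqrt_nonneg _) hstep
      ((hchain i i₀).lift γ fun a b hab =>
        hab.trans (measure_mono (inter_subset_inter (hVW a) (hVW b))))
  -- Measuring `W g` in units of `β` cancels the `β` in `δ ^ 2`, leaving no dependence on the size
  -- of `T`.
  have hvol : ∀ g, volume.real (W g) ≤ (ϱ ^ d)⁻¹ * β := fun g => by
    rw [hβ, volumeReal_ball_mul _ hϱ, inv_mul_cancel_left₀ (by positivity)]
    exact ENNReal.toReal_mono measure_ball_lt_top.ne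
      ((measure_mono (hWT g)).trans (volume_le_volume_ball_diam hb))
  have hW : ∀ g, ∫ x in W g, (p x - A (γ i₀)) ^ 2 ≤
      (2 * K₁ + 8 * m ^ 2 * K₁ * (ϱ ^ d)⁻¹) * G := by
    intro g
    rcases (W g).eq_empty_or_nonempty with h | ⟨x, hx⟩
    · rw [h]; simp; positivity
    obtain ⟨i, rfl, -⟩ := mem_iUnion₂.1 hx
    set A₀ := A (γ i₀)
    have h1 : (A (γ i) - A₀) ^ 2 ≤ m ^ 2 * (4 * K₁ * G / β) := by
      rw [← hδ2, ← mul_pow, ← sq_abs]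
      exact pow_le_pow_left₀ (abs_nonneg _) (hall i) 2
    calc ∫ x in W (γ i), (p x - A₀) ^ 2
        ≤ ∫ x in W (γ i), (2 * (p x - A (γ i)) ^ 2 + 2 * (A (γ i) - A₀) ^ 2) :=
          setIntegral_mono (hint (hWT _) (by fun_prop)) (hint (hWT _) (by fun_prop)) fun x => by
            simp only
            nlinarith [sq_nonneg ((p x - A (γ i)) - (A (γ i) - A₀))]
      _ = 2 * (∫ x in W (γ i), (p x - A (γ i)) ^ 2) +
            volume.real (W (γ i)) * (2 * (A (γ i) - A₀) ^ 2) := by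
          rw [integral_add (hint (hWT _) (by fun_prop)) (hint (hWT _) (by fun_prop)),
            integral_const_mul, setIntegral_const, smul_eq_mul]
      _ ≤ 2 * (K₁ * G) + (ϱ ^ d)⁻¹ * β * (2 * (m ^ 2 * (4 * K₁ * G / β))) := by
          gcongr
          · exact hA _
          · exact hvol _
      _ = _ := by field_simp; ring
  calc ∫ x in T, (p x - A (γ i₀)) ^ 2
      ≤ ∑ g, ∫ x in W g, (p x - A (γ i₀)) ^ 2 := by
        conv_lhs => rw [hTW]
        exact setIntegral_iUnion_le (fun g => hint (hWT g) (by fun_prop)) fun x => sq_nonneg _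
    _ ≤ ∑ _ : t, (2 * K₁ + 8 * m ^ 2 * K₁ * (ϱ ^ d)⁻¹) * G := Finset.sum_le_sum fun g _ => hW g
    _ ≤ _ := by
        rw [Finset.sum_const, nsmul_eq_mul, Finset.card_univ]
        change m * _ ≤ _
        linarith

end Geometry

end HHO

namespace HHO

/-! ### The stabilisation bounds -/

section Stabilisation

variable {d : ℕ} {T : Set (Space d)}

/-- The cross term vanishes by the zero mean, so zero is the best constant and the unspecified one
in the Poincaré inequality can be dropped. -/
theorem integral_sq_le_integral_sq_sub (hb : Bornology.IsBounded T) {p : Space d → ℝ}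
    (hp : Continuous p) (h0 : ∫ x in T, p x = 0) (a : ℝ) :
    ∫ x in T, p x ^ 2 ≤ ∫ x in T, (p x - a) ^ 2 := by
  have hi : ∀ {f : Space d → ℝ}, Continuous f → IntegrableOn f T := fun hf =>
    integrableOn_of_continuous hb hf
  have e : ∀ x, (p x - a) ^ 2 = p x ^ 2 + (a ^ 2 - 2 * a * p x) := fun x => by ring
  simp only [e]
  rw [integral_add (hi (by fun_prop)) (hi (by fun_prop)),
    integral_sub (hi (by fun_prop)) (hi (by fun_prop)), integral_const_mul, h0]
  have : 0 ≤ ∫ x in T, a ^ 2 := integral_nonneg fun x => by positivity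
  linarith

/-- The `L²` projection is a contraction. -/
theorem elemInner_elemProj_le (hT : MeasurableSet T) (hb : Bornology.IsBounded T) {p : Space d → ℝ}
    (hp : Continuous p) (l : ℕ) :
    elemInner T (elemProj T l p) (elemProj T l p) ≤ ∫ x in T, p x ^ 2 := by
  have : IsFiniteMeasure (volume.restrict T : Measure (Space d)) :=
    ⟨by simpa using hb.measure_lt_top⟩
  have hi : ∀ {f : Space d → ℝ}, Continuous f → IntegrableOn f T := fun hf =>
    integrableOn_of_continuous hb hf
  obtain ⟨hq, horth⟩ := l2Projection_spec hb (ae_restrict_mem hT) l (hi hp)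
  set q := elemProj T l p with hqdef
  change q ∈ polyFun d l at hq
  have hqc := (polyFun_contDiff hq (n := 0)).continuous
  have h1 : ∫ x in T, (p x - q x) * q x = 0 := horth q hq
  have h2 : 0 ≤ ∫ x in T, (p x - q x) ^ 2 := integral_nonneg fun x => sq_nonneg _
  have e : ∀ x, p x ^ 2 = (p x - q x) ^ 2 + (2 * ((p x - q x) * q x) + q x * q x) :=
    fun x => by ring
  rw [elemInner]
  simp only [e]
  rw [integral_add (hi (by fun_prop)) (hi (by fun_prop)),
    integral_add (hi (by fun_prop)) (hi (by fun_prop)), integral_const_mul, h1]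
  linarith

theorem gradInner_self (p : Space d → ℝ) :
    gradInner T p p = ∫ x in T, ‖fderiv ℝ p x‖ ^ 2 := by
  simp [gradInner, gradient]

/-- Isolates the only term in which the form and the reduced energy differ; both stabilisation
bounds are read off from it. -/
theorem localForm_stab_self (𝓕 : Finset (Set (Space d))) {k l : ℕ} (v : LocalSpace 𝓕 k l) :
    localForm T 𝓕 (stab T 𝓕) v v = reducedEnergy T 𝓕 v +
      (diam T ^ 2)⁻¹ * elemInner T (deltaElem T 𝓕 v) (deltaElem T 𝓕 v) := by
  simp only [localForm, stab, reducedEnergy]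
  ring

theorem elemInner_self_nonneg (f : Space d → ℝ) : 0 ≤ elemInner T f f :=
  integral_nonneg fun _ => mul_self_nonneg _

theorem gradInner_self_nonneg (f : Space d → ℝ) : 0 ≤ gradInner T f f :=
  integral_nonneg fun _ => real_inner_self_nonneg

theorem reducedEnergy_nonneg (𝓕 : Finset (Set (Space d))) {k l : ℕ} (v : LocalSpace 𝓕 k l) :
    0 ≤ reducedEnergy T 𝓕 v :=
  add_nonneg (gradInner_self_nonneg _)
    (mul_nonneg (inv_nonneg.2 diam_nonneg) (integral_nonneg fun _ => mul_self_nonneg _))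

theorem gradInner_le_reducedEnergy (𝓕 : Finset (Set (Space d))) {k l : ℕ}
    (v : LocalSpace 𝓕 k l) :
    gradInner T (potential T 𝓕 v) (potential T 𝓕 v) ≤ reducedEnergy T 𝓕 v :=
  le_add_of_nonneg_right
    (mul_nonneg (inv_nonneg.2 diam_nonneg) (integral_nonneg fun _ => mul_self_nonneg _))

/-- The zero element component is what makes this work: the closure condition gives the
reconstruction zero mean, and the element difference becomes its plain projection. Contraction and
Poincaré then conclude. -/
theorem inv_mul_elemInner_deltaElem_le {Ω : Set (Space d)} (M : PolytopalMesh Ω)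
    (hT : T ∈ M.elements) {k l : ℕ} {K : ℝ} (hK : 0 ≤ K)
    (hpoinc : ∀ p : Space d → ℝ, ContDiff ℝ 1 p → ∃ a : ℝ, ∫ x in T, (p x - a) ^ 2 ≤
      K * (diam T ^ 2 * ∫ x in T, ‖fderiv ℝ p x‖ ^ 2)) (v : brokenPoly (M.facesOf T) k) :
    let w : LocalSpace (M.facesOf T) k l := (0, v)
    (diam T ^ 2)⁻¹ * elemInner T (deltaElem T (M.facesOf T) w) (deltaElem T (M.facesOf T) w) ≤
      K * gradInner T (potential T (M.facesOf T) w) (potential T (M.facesOf T) w) := by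
  intro w
  have hP := M.element_polytope T hT
  obtain ⟨hp, -, hmean⟩ := potential_spec M hT w
  set p := potential T (M.facesOf T) w with hpdef
  have hpc := (polyFun_contDiff hp (n := 0)).continuous
  have h0 : ∫ x in T, p x = 0 := by simpa [w, integral_neg] using hmean
  have hδ : deltaElem T (M.facesOf T) w = elemProj T l p := by
    simp [deltaElem, w, hpdef]
  obtain ⟨a, ha⟩ := hpoinc p (polyFun_contDiff hp (n := 1))
  have h1 := (elemInner_elemProj_le hP.isOpen.measurableSet hP.isBounded hpc l).trans
    ((integral_sq_le_integral_sq_sub hP.isBounded hpc h0 a).trans ha)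
  rw [hδ, gradInner_self]
  have hn : 0 ≤ ∫ x in T, ‖fderiv ℝ p x‖ ^ 2 := integral_nonneg fun x => by positivity
  -- If the diameter were zero, its inverse would be zero by convention and the left side would
  -- vanish.
  rcases (sq_nonneg (diam T)).eq_or_lt with h | h
  · rw [← h]; simp; positivity
  · rw [inv_mul_le_iff₀ h]; linarith

end Stabilisation

end HHO

theorem mainTheorem4 (d : ℕ) (hd : 2 ≤ d) (ϱ : ℝ) (hϱ : 0 < ϱ) :
    ∃ C : ℝ, 0 < C ∧
      ∀ (Ω : Set (HHO.Space d)), HHO.IsPolytope Ω →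
      ∀ M : HHO.PolytopalMesh Ω, M.IsRegular ϱ →
      ∀ T ∈ M.elements, ∀ k l : ℕ, k ≤ l + 1 →
        HHO.SatisfiesStabBounds T (M.facesOf T) (k := k) (l := l)
          (HHO.stab T (M.facesOf T)) C := by
  have : NeZero d := ⟨by omega⟩
  obtain ⟨K, hK, hpoinc⟩ := HHO.exists_poincare_const d hϱ
  -- The `1` accounts for the reduced energy inside the form and `K` for the element term; the lower
  -- bound only needs the `1`.
  refine ⟨1 + K, by positivity, fun Ω _ M hM T hT k l _ => ⟨fun v => ?_, fun v => ?_⟩⟩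
  · rw [HHO.localForm_stab_self]
    have h1 := HHO.reducedEnergy_nonneg (T := T) (M.facesOf T) v
    have h2 : 0 ≤ (diam T ^ 2)⁻¹ * HHO.elemInner T (HHO.deltaElem T (M.facesOf T) v)
        (HHO.deltaElem T (M.facesOf T) v) :=
      mul_nonneg (by positivity) (HHO.elemInner_self_nonneg _)
    nlinarith [mul_nonneg hK.le (add_nonneg h1 h2)]
  · rw [HHO.localForm_stab_self]
    have h1 := HHO.inv_mul_elemInner_deltaElem_le M hT (l := l) hK.le (hpoinc T (hM T hT)) v
    have h2 := mul_le_mul_of_nonneg_left (HHO.gradInner_le_reducedEnergy (T := T) (M.facesOf T)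
      ((0, v) : HHO.LocalSpace (M.facesOf T) k l)) hK.le
    linarith
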